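/- Fix integers $n,k\ge 1$. Let $\mathrm{Form}_n$ be the set of formulas over the variables $X_1,\dots,X_n$ in the language $\wedge,\vee,\to,\neg,\bot,\top$. Write $\vdash\alpha$ if $\alpha$ is derivable in Gödel logic $\mathbb G_\infty$ (the intuitionistic propositional calculus plus the axiom scheme $(\alpha\to\beta)\vee(\beta\to\alpha)$, with modus ponens). Let $\mathcal G_n=\mathrm{Form}_n/{\equiv}$ be its Lindenbaum algebra, where $\varphi\equiv\psi$ means $\vdash\varphi\to\psi$ and $\vdash\psi\to\varphi$; it is a bounded distributive lattice. The height $h(g)$ of a join-irreducible $g\in\mathcal G_n$ is the largest $l$ for which there is a chain $g=g_1>g_2>\dots>g_l$ of join-irreducible elements of $\mathcal G_n$. The generalised characteristic $\chi_k:\mathcal G_n\to\mathbb R$ is the unique function with $\chi_k(x)+\chi_k(y)=\chi_k(x\vee y)+\chi_k(x\wedge y)$ for all $x,y$, with $\chi_k(\bot)=0$, and with $\chi_k(g)=\min\{h(g),k\}$ for every join-irreducible $g$; put $\chi_k(\varphi)=\chi_k([\varphi]_\equiv)$ for $\varphi\in\mathrm{Form}_n$. An assignment is a map $\mu:\mathrm{Form}_n\to[0,1]$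 with $\mu(\alpha\wedge\beta)=\min\{\mu(\alpha),\mu(\beta)\}$, $\mu(\alpha\vee\beta)=\max\{\mu(\alpha),\mu(\beta)\}$, $\mu(\alpha\to\beta)=1$ if $\mu(\alpha)\le\mu(\beta)$ and $\mu(\alpha\to\beta)=\mu(\beta)$ otherwise, $\mu(\neg\alpha)=\mu(\alpha\to\bot)$, $\mu(\bot)=0$, $\mu(\top)=1$. It is $(k+1)$-valued if its values lie in $\{0,\frac1k,\dots,\frac{k-1}k,1\}$. A tautology of $\mathbb G_\infty$ (respectively of $\mathbb G_{k+1}$) is a formula that has value $1$ under all assignments (respectively under all $(k+1)$-valued assignments). Two $(k+1)$-valued assignments $\mu,\nu$ are $n$-equivalent if there are a permutation $\sigma$ of $\{1,\dots,n\}$ and relations $\preceq_0,\dots,\preceq_n$, each of them $<$ or $=$, such that $0\preceq_0\mu(X_{\sigma(1)})\preceq_1\cdots\preceq_{n-1}\mu(X_{\sigma(n)})\preceq_n1$ and $0\preceq_0\nu(X_{\sigma(1)})\preceq_1\cdots\preceq_{n-1}\nu(X_{\sigma(n)})\preceq_n1$; this is an equivalence relation. Finally, let $P(n,k)=\sum_{i=1}^k\sum_{j=0}^n\binom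 nj T(j,i)$, where, for $m\ge0$ and $l\ge1$, $T(m,l)=1$ if $l=1$, $T(m,l)=0$ if $l>m+1$, and $T(m,l)=\sum_{i=1}^m\binom mi T(m-i,l-1)$ otherwise. Theorem. Let $\varphi\in\mathrm{Form}_n$. The function $\chi_k$ is well defined (it exists and is unique), and: (1) $\chi_k(\varphi)$ equals the (finite) number of $n$-equivalence classes of $(k+1)$-valued assignments $\mu$ with $\mu(\varphi)=1$. (2) $\varphi$ is a tautology of $\mathbb G_{k+1}$ if and only if $\chi_k(\varphi)=P(n,k)$. (3) $\varphi$ is a tautology of $\mathbb G_\infty$ if and only if it is a tautology of $\mathbb G_{n+2}$, if and only if $\chi_{n+1}(\varphi)=P(n,n+1)$. -/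

import Mathlib

namespace GodelLogic

/-- Formulas in the propositional variables `X_1, …, X_n` (here `var 0, …, var (n-1)`). -/
inductive Form (n : ℕ) : Type
  | var : Fin n → Form n
  | bot : Form n
  | top : Form n
  | neg : Form n → Form n
  | and : Form n → Form n → Form n
  | or : Form n → Form n → Form n
  | imp : Form n → Form n → Form n

open Form

/-- Derivability in infinite-valued Gödel logic: intuitionistic propositional calculus together
with the prelinearity axiom scheme; modus ponens is the only rule. -/
inductive Derivable {n : ℕ} : Form n → Prop
  | k (α β : Form n) : Derivable (imp α (imp β α))
  | s (α β γ : Form n) :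
      Derivable (imp (imp α (imp β γ)) (imp (imp α β) (imp α γ)))
  | and_left (α β : Form n) : Derivable (imp (and α β) α)
  | and_right (α β : Form n) : Derivable (imp (and α β) β)
  | and_intro (α β : Form n) : Derivable (imp α (imp β (and α β)))
  | or_left (α β : Form n) : Derivable (imp α (or α β))
  | or_right (α β : Form n) : Derivable (imp β (or α β))
  | or_elim (α β γ : Form n) :
      Derivable (imp (imp α γ) (imp (imp β γ) (imp (or α β) γ)))
  | bot_elim (α : Form n) : Derivable (imp bot α)
  | top_intro : Derivable top
  | neg_elim (α : Form n) : Derivable (imp (neg α) (imp α bot))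
  | neg_intro (α : Form n) : Derivable (imp (imp α bot) (neg α))
  | prelinearity (α β : Form n) : Derivable (or (imp α β) (imp β α))
  | mp {α β : Form n} : Derivable (imp α β) → Derivable α → Derivable β

namespace Derivable

variable {n : ℕ} {α β γ δ : Form n}

theorem const (h : Derivable α) : Derivable (imp β α) := mp (k α β) h

theorem ap (h : Derivable (imp δ (imp α β))) (h' : Derivable (imp δ α)) :
    Derivable (imp δ β) := mp (mp (s δ α β) h) h'

theorem refl (α : Form n) : Derivable (imp α α) := ap (k α (imp α α)) (k α α)

theorem trans (h : Derivable (imp α β)) (h' : Derivable (imp β γ)) :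
    Derivable (imp α γ) := ap (const h') h

theorem and_i (h : Derivable (imp δ α)) (h' : Derivable (imp δ β)) :
    Derivable (imp δ (and α β)) := ap (trans h (and_intro α β)) h'

theorem or_e (h : Derivable (imp α γ)) (h' : Derivable (imp β γ)) :
    Derivable (imp (or α β) γ) := mp (mp (or_elim α β γ) h) h'

theorem uncurry (h : Derivable (imp α (imp β γ))) : Derivable (imp (and α β) γ) :=
  ap (trans (and_left α β) h) (and_right α β)

theorem curry (h : Derivable (imp (and α β) γ)) : Derivable (imp α (imp β γ)) :=
  trans (and_intro α β) (mp (s β (and α β) γ) (const h))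

end Derivable

/-- Logical equivalence: `⊢ φ → ψ` and `⊢ ψ → φ`. -/
def logEquiv (n : ℕ) : Setoid (Form n) where
  r φ ψ := Derivable (imp φ ψ) ∧ Derivable (imp ψ φ)
  iseqv :=
    { refl := fun φ => ⟨.refl φ, .refl φ⟩
      symm := fun h => ⟨h.2, h.1⟩
      trans := fun h h' => ⟨h.1.trans h'.1, h'.2.trans h.2⟩ }

/-- The Lindenbaum algebra of Gödel logic over `n` variables. -/
def Lindenbaum (n : ℕ) : Type := Quotient (logEquiv n)

/-- The class of a formula modulo logical equivalence. -/
def cls {n : ℕ} (φ : Form n) : Lindenbaum n := Quotient.mk (logEquiv n) φ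

instance (n : ℕ) : LE (Lindenbaum n) where
  le := Quotient.lift₂ (fun φ ψ => Derivable (imp φ ψ)) (fun _ _ _ _ h h' =>
    propext ⟨fun d => (h.2.trans d).trans h'.1, fun d => (h.1.trans d).trans h'.2⟩)

instance (n : ℕ) : Max (Lindenbaum n) where
  max := Quotient.map₂ or (fun _ _ h _ _ h' =>
    ⟨.or_e (h.1.trans (.or_left _ _)) (h'.1.trans (.or_right _ _)),
      .or_e (h.2.trans (.or_left _ _)) (h'.2.trans (.or_right _ _))⟩)

instance (n : ℕ) : Min (Lindenbaum n) where
  min := Quotient.map₂ and (fun _ _ h _ _ h' =>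
    ⟨.and_i ((Derivable.and_left _ _).trans h.1) ((Derivable.and_right _ _).trans h'.1),
      .and_i ((Derivable.and_left _ _).trans h.2) ((Derivable.and_right _ _).trans h'.2)⟩)

instance (n : ℕ) : HImp (Lindenbaum n) where
  himp := Quotient.map₂ imp (fun _ _ h _ _ h' =>
    ⟨.curry (((Derivable.and_i (.and_left _ _) ((Derivable.and_right _ _).trans h.2)).trans
        (.uncurry (.refl _))).trans h'.1),
      .curry (((Derivable.and_i (.and_left _ _) ((Derivable.and_right _ _).trans h.1)).trans
        (.uncurry (.refl _))).trans h'.2)⟩)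

instance (n : ℕ) : Compl (Lindenbaum n) where
  compl := Quotient.map neg (fun _ _ h =>
    ⟨(Derivable.curry ((Derivable.and_i (.and_left _ _)
        ((Derivable.and_right _ _).trans h.2)).trans (.uncurry (.neg_elim _)))).trans
        (.neg_intro _),
      (Derivable.curry ((Derivable.and_i (.and_left _ _)
        ((Derivable.and_right _ _).trans h.1)).trans (.uncurry (.neg_elim _)))).trans
        (.neg_intro _)⟩)

instance (n : ℕ) : Top (Lindenbaum n) := ⟨cls top⟩

instance (n : ℕ) : Bot (Lindenbaum n) := ⟨cls bot⟩

/-- The operations induced by the connectives make the Lindenbaum algebra a Heyting algebra,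
in particular a bounded distributive lattice. -/
instance (n : ℕ) : HeytingAlgebra (Lindenbaum n) where
  le_refl := by rintro ⟨φ⟩; exact Derivable.refl φ
  le_trans := by rintro ⟨φ⟩ ⟨ψ⟩ ⟨χ⟩ h h'; exact Derivable.trans h h'
  le_antisymm := by rintro ⟨φ⟩ ⟨ψ⟩ h h'; exact Quotient.sound ⟨h, h'⟩
  sup := max
  inf := min
  le_sup_left := by rintro ⟨φ⟩ ⟨ψ⟩; exact Derivable.or_left φ ψ
  le_sup_right := by rintro ⟨φ⟩ ⟨ψ⟩; exact Derivable.or_right φ ψ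
  sup_le := by rintro ⟨φ⟩ ⟨ψ⟩ ⟨χ⟩ h h'; exact Derivable.or_e h h'
  inf_le_left := by rintro ⟨φ⟩ ⟨ψ⟩; exact Derivable.and_left φ ψ
  inf_le_right := by rintro ⟨φ⟩ ⟨ψ⟩; exact Derivable.and_right φ ψ
  le_inf := by rintro ⟨φ⟩ ⟨ψ⟩ ⟨χ⟩ h h'; exact Derivable.and_i h h'
  le_top := by rintro ⟨φ⟩; exact Derivable.const .top_intro
  bot_le := by rintro ⟨φ⟩; exact Derivable.bot_elim φ
  le_himp_iff := by rintro ⟨φ⟩ ⟨ψ⟩ ⟨χ⟩; exact ⟨Derivable.uncurry, Derivable.curry⟩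
  himp_bot := by rintro ⟨φ⟩; exact Quotient.sound ⟨.neg_intro φ, .neg_elim φ⟩

/-- A valuation on a lattice. -/
def IsValuation {L : Type*} [Lattice L] (ν : L → ℝ) : Prop :=
  ∀ x y, ν x + ν y = ν (x ⊔ y) + ν (x ⊓ y)

/-- The height of a join-irreducible element `g`: the largest length (number of elements) of a
chain `g = g₁ > g₂ > ⋯ > g_l` of join-irreducible elements. `Order.height` counts the strict
inequalities in such a chain, whence the `+ 1`. -/
noncomputable def height {L : Type*} [Lattice L] (g : {x : L // SupIrred x}) : ℕ∞ :=
  Order.height g + 1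

/-- `ν` is a valuation with `ν ⊥ = 0` and `ν g = min {h(g), k}` at every join-irreducible `g`. -/
structure IsGenChar (n k : ℕ) (ν : Lindenbaum n → ℝ) : Prop where
  valuation : IsValuation ν
  map_bot : ν ⊥ = 0
  map_supIrred : ∀ g : {x : Lindenbaum n // SupIrred x},
    ν g = ((min (height g) (k : ℕ∞)).toNat : ℝ)

open Classical in
/-- The generalised characteristic `χ_k` on the Lindenbaum algebra: the valuation of
`IsGenChar n k`. -/
noncomputable def genChar (n k : ℕ) : Lindenbaum n → ℝ :=
  if h : ∃ ν, IsGenChar n k ν then h.choose else 0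

/-- The generalised characteristic of a formula. -/
noncomputable def chi {n : ℕ} (k : ℕ) (φ : Form n) : ℝ := genChar n k (cls φ)

/-- Assignments with values in the real unit interval. -/
structure IsAssignment {n : ℕ} (μ : Form n → unitInterval) : Prop where
  map_and : ∀ α β, μ (and α β) = min (μ α) (μ β)
  map_or : ∀ α β, μ (or α β) = max (μ α) (μ β)
  map_imp : ∀ α β, μ (imp α β) = if μ α ≤ μ β then 1 else μ β
  map_neg : ∀ α, μ (neg α) = μ (imp α bot)
  map_bot : μ bot = 0
  map_top : μ top = 1

/-- The set `{0, 1/(m-1), …, (m-2)/(m-1), 1}` of `m` truth values, for `m ≥ 2`. -/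
def truthValues (m : ℕ) : Set ℝ :=
  {x | ∃ i : ℕ, i ≤ m - 1 ∧ x = (i : ℝ) / ((m - 1 : ℕ) : ℝ)}

/-- The `m`-valued assignments. -/
def FinAssignment (n m : ℕ) : Type :=
  {μ : Form n → unitInterval // IsAssignment μ ∧ ∀ α, (μ α : ℝ) ∈ truthValues m}

/-- Tautologies of infinite-valued Gödel logic. -/
def IsTautology {n : ℕ} (φ : Form n) : Prop :=
  ∀ μ : Form n → unitInterval, IsAssignment μ → μ φ = 1

/-- Tautologies of `m`-valued Gödel logic. -/
def IsFinTautology {n : ℕ} (m : ℕ) (φ : Form n) : Prop :=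
  ∀ μ : FinAssignment n m, μ.1 φ = 1

/-- The sequence `0, μ(X_{σ(1)}), …, μ(X_{σ(n)}), 1`. -/
def arranged {n : ℕ} (μ : Form n → unitInterval) (σ : Equiv.Perm (Fin n)) :
    Fin (n + 2) → unitInterval :=
  Fin.cons 0 (Fin.snoc (fun i => μ (var (σ i))) 1 : Fin (n + 1) → unitInterval)

/-- The sequence `a` satisfies `a₀ ≼₀ a₁ ≼₁ ⋯ ≼ₙ aₙ₊₁`, where `≼ᵢ` is `<` if `r i` is true and
`=` otherwise. -/
def Follows {n : ℕ} (a : Fin (n + 2) → unitInterval) (r : Fin (n + 1) → Bool) : Prop :=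
  ∀ i : Fin (n + 1),
    if r i = true then a i.castSucc < a i.succ else a i.castSucc = a i.succ

/-- `n`-equivalence. -/
def NEquiv {n : ℕ} (μ ν : Form n → unitInterval) : Prop :=
  ∃ (σ : Equiv.Perm (Fin n)) (r : Fin (n + 1) → Bool),
    Follows (arranged μ σ) r ∧ Follows (arranged ν σ) r

theorem Follows.monotone {n : ℕ} {a : Fin (n + 2) → unitInterval} {r : Fin (n + 1) → Bool}
    (h : Follows a r) : Monotone a := by
  refine Fin.monotone_iff_le_succ.2 fun i => ?_
  have := h i
  split_ifs at this
  exacts [this.le, this.le]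

theorem Follows.lt_imp {n : ℕ} {a b : Fin (n + 2) → unitInterval} {r : Fin (n + 1) → Bool}
    (ha : Follows a r) (hb : Follows b r) {i j : Fin (n + 2)} (h : a i < a j) : b i < b j := by
  have hij : i < j := ha.monotone.reflect_lt h
  by_contra hc
  have hstep : ∀ m : ℕ, ∀ hm : m < n + 2, i.1 ≤ m → m ≤ j.1 → a ⟨m, hm⟩ = a i := by
    intro m
    induction m with
    | zero =>
      intro hm h1 _
      congr 1
      ext
      simp only
      omega
    | succ m ih =>
      intro hm h1 h2
      rcases Nat.lt_or_ge m i.1 with h3 | h3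
      · congr 1
        ext
        simp only
        omega
      · have e := ih (by omega) h3 (by omega)
        have hA := ha ⟨m, by omega⟩
        have hB := hb ⟨m, by omega⟩
        by_cases hr : r ⟨m, by omega⟩ = true
        · rw [if_pos hr] at hB
          exact absurd (lt_of_le_of_lt (hb.monotone (show i ≤ ⟨m, by omega⟩ from h3))
            (lt_of_lt_of_le hB (hb.monotone (show (⟨m + 1, hm⟩ : Fin (n + 2)) ≤ j from h2)))) hc
        · rw [if_neg hr] at hA
          exact hA.symm.trans e
  exact absurd (hstep j.1 j.2 hij.le le_rfl) h.ne'

theorem arranged_zero {n : ℕ} (μ : Form n → unitInterval) (σ : Equiv.Perm (Fin n)) :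
    arranged μ σ 0 = 0 := rfl

theorem arranged_var {n : ℕ} (μ : Form n → unitInterval) (σ : Equiv.Perm (Fin n)) (i : Fin n) :
    arranged μ σ i.castSucc.succ = μ (var (σ i)) := by
  simp only [arranged, Fin.cons_succ, Fin.snoc_castSucc]

theorem arranged_last {n : ℕ} (μ : Form n → unitInterval) (σ : Equiv.Perm (Fin n)) :
    arranged μ σ (Fin.last n).succ = 1 := by
  simp only [arranged, Fin.cons_succ, Fin.snoc_last]

/-- `μ` and `ν` induce the same strict inequalities among `0`, the variables, and `1`. -/
def SameOrder {n : ℕ} (μ ν : Form n → unitInterval) : Prop :=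
  (∀ i, 0 < μ (var i) ↔ 0 < ν (var i)) ∧ (∀ i, μ (var i) < 1 ↔ ν (var i) < 1) ∧
    ∀ i j, μ (var i) < μ (var j) ↔ ν (var i) < ν (var j)

theorem NEquiv.symm {n : ℕ} {μ ν : Form n → unitInterval} (h : NEquiv μ ν) : NEquiv ν μ := by
  obtain ⟨σ, r, h1, h2⟩ := h
  exact ⟨σ, r, h2, h1⟩

theorem NEquiv.sameOrder {n : ℕ} {μ ν : Form n → unitInterval} (h : NEquiv μ ν) :
    SameOrder μ ν := by
  obtain ⟨σ, r, h1, h2⟩ := h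
  have key : ∀ p q, arranged μ σ p < arranged μ σ q ↔ arranged ν σ p < arranged ν σ q :=
    fun p q => ⟨h1.lt_imp h2, h2.lt_imp h1⟩
  refine ⟨fun i => ?_, fun i => ?_, fun i j => ?_⟩
  · simpa [arranged_zero, arranged_var] using key 0 (σ.symm i).castSucc.succ
  · have := key (σ.symm i).castSucc.succ (Fin.last n).succ
    rw [arranged_var, arranged_var, arranged_last, arranged_last] at this
    simpa using this
  · simpa [arranged_var] using key (σ.symm i).castSucc.succ (σ.symm j).castSucc.succ

theorem SameOrder.arranged_lt {n : ℕ} {μ ν : Form n → unitInterval} (h : SameOrder μ ν)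
    (σ : Equiv.Perm (Fin n)) (p q : Fin (n + 2)) :
    arranged μ σ p < arranged μ σ q ↔ arranged ν σ p < arranged ν σ q := by
  obtain ⟨h0, h1, h2⟩ := h
  have nlt : ∀ x : unitInterval, ¬ x < 0 := fun x => not_lt.2 (unitInterval.nonneg x)
  have ngt : ∀ x : unitInterval, ¬ 1 < x := fun x => not_lt.2 (unitInterval.le_one x)
  induction p using Fin.cases with
  | zero =>
    induction q using Fin.cases with
    | zero => simp
    | succ q =>
      induction q using Fin.lastCases with
      | last => rw [arranged_last, arranged_last, arranged_zero, arranged_zero]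
      | cast q => rw [arranged_var, arranged_var, arranged_zero, arranged_zero]; exact h0 _
  | succ p =>
    induction q using Fin.cases with
    | zero => rw [arranged_zero, arranged_zero]; exact iff_of_false (nlt _) (nlt _)
    | succ q =>
      induction p using Fin.lastCases with
      | last => rw [arranged_last, arranged_last]; exact iff_of_false (ngt _) (ngt _)
      | cast p =>
        induction q using Fin.lastCases with
        | last =>
          rw [arranged_last, arranged_last, arranged_var, arranged_var]; exact h1 _
        | cast q => simp only [arranged_var]; exact h2 _ _

theorem monotone_arranged_sort {n : ℕ} (μ : Form n → unitInterval) :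
    Monotone (arranged μ (Tuple.sort fun i => μ (var i))) := by
  have hs : Monotone (fun i => μ (var (Tuple.sort (fun i => μ (var i)) i))) :=
    Tuple.monotone_sort fun i => μ (var i)
  intro p q hpq
  induction p using Fin.cases with
  | zero => exact unitInterval.nonneg _
  | succ p =>
    induction q using Fin.cases with
    | zero => exact absurd hpq (not_le.2 (Fin.succ_pos p))
    | succ q =>
      induction q using Fin.lastCases with
      | last => rw [arranged_last]; exact unitInterval.le_one _
      | cast q =>
        induction p using Fin.lastCases with
        | last =>
          exact absurd (Fin.succ_le_succ_iff.1 hpq) (not_le.2 (Fin.castSucc_lt_last q))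
        | cast p =>
          rw [arranged_var, arranged_var]
          exact hs (Fin.castSucc_le_castSucc_iff.1 (Fin.succ_le_succ_iff.1 hpq))

theorem SameOrder.nEquiv {n : ℕ} {μ ν : Form n → unitInterval} (h : SameOrder μ ν) :
    NEquiv μ ν := by
  classical
  have hm := monotone_arranged_sort μ
  have hl := h.arranged_lt (Tuple.sort fun i => μ (var i))
  refine ⟨Tuple.sort fun i => μ (var i), fun i => decide
    (arranged μ (Tuple.sort fun i => μ (var i)) i.castSucc <
      arranged μ (Tuple.sort fun i => μ (var i)) i.succ), fun i => ?_, fun i => ?_⟩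
  · split_ifs with hd
    · exact of_decide_eq_true hd
    · exact ((hm i.castSucc_lt_succ.le).lt_or_eq).resolve_left (by simpa using hd)
  · split_ifs with hd
    · exact (hl _ _).1 (of_decide_eq_true hd)
    · have hd' := mt (hl _ _).2 (of_decide_eq_false (by simpa using hd))
      have hc := mt (hl _ _).2 (not_lt.2 (hm i.castSucc_lt_succ.le))
      exact le_antisymm (not_lt.1 hc) (not_lt.1 hd')

/-- `n`-equivalence as an equivalence relation on `m`-valued assignments. -/
def nEquivSetoid (n m : ℕ) : Setoid (FinAssignment n m) where
  r μ ν := NEquiv μ.1 ν.1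
  iseqv :=
    { refl := fun _ => SameOrder.nEquiv
        ⟨fun _ => Iff.rfl, fun _ => Iff.rfl, fun _ _ => Iff.rfl⟩
      symm := fun h => h.symm
      trans := fun h h' =>
        have s := h.sameOrder
        have s' := h'.sameOrder
        SameOrder.nEquiv ⟨fun i => (s.1 i).trans (s'.1 i), fun i => (s.2.1 i).trans (s'.2.1 i),
          fun i j => (s.2.2 i j).trans (s'.2.2 i j)⟩ }

/-- The set of `n`-equivalence classes of `m`-valued assignments `μ` with `μ φ = 1`. -/
def modelClasses {n : ℕ} (m : ℕ) (φ : Form n) : Set (Quotient (nEquivSetoid n m)) :=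
  {c | ∃ μ : FinAssignment n m, μ.1 φ = 1 ∧ Quotient.mk (nEquivSetoid n m) μ = c}

/-- The numbers `T(n, k)` for `k ≥ 1` (with the unused value `0` at `k = 0`). -/
def T : ℕ → ℕ → ℕ
  | _, 0 => 0
  | _, 1 => 1
  | n, k + 2 =>
    if k + 2 > n + 1 then 0 else ∑ i ∈ Finset.Icc 1 n, n.choose i * T (n - i) (k + 1)

/-- `P(n, k) = ∑_{i=1}^k ∑_{j=0}^n (n choose j) T(j, i)`. -/
def P (n k : ℕ) : ℕ :=
  ∑ i ∈ Finset.Icc 1 k, ∑ j ∈ Finset.range (n + 1), n.choose j * T j i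

end GodelLogic

/-!
The Lindenbaum algebra `𝒢ₙ` is finite, so a join-irreducible element `g` is the same as a prime filter
`{a | g ≤ a}`, and the quotient of `𝒢ₙ` by a prime filter is a chain `0 < ⋯ < M` with `M ≤ n + 1`,
generated by the variables (`exists_eval_of_isPrimeFilter`). Thus `g` corresponds to an evaluation of
the formulas in this chain, whose theory (the set of formulas with value `⊤`) is the filter. The
prime filters containing it are the sets `{a | t ≤ evalL f a}` for the thresholds `1 ≤ t ≤ M`, hence
the join-irreducible elements below `g` form a chain with `M` elements and `g` has height `M`
(`height_eq`).

Two assignments are `n`-equivalent exactly when they have the same theory (`nEquiv_iff`). An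
assignment satisfies a formula representing `g` exactly when its theory is one of the filters
`{a | t ≤ evalL f a}`, and this theory is realised by a `(k + 1)`-valued assignment exactly when
`t ≤ k`. Therefore the number of classes of `(k + 1)`-valued models of `g` is `min M k`
(`ncard_modelClasses_of_supIrred`). Counting classes of models is a valuation vanishing at `⊥`, so it
is the generalised characteristic; uniqueness is an induction in a finite lattice
(`IsValuation.ext_of_supIrred`).

A formula is a tautology of `𝔾ₖ₊₁` if and only if all classes are classes of models. Every class is
represented by a unique evaluation onto a chain `0 < ⋯ < M` with `1 ≤ M ≤ k`, that is, by a function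
from the variables to the chain attaining all values other than `0` and `M`; splitting these functions
by their fibre over `0` gives the recursion of `T`, and their number is `P n k`
(`card_nEquiv_classes`). Since `M ≤ n + 1`, every theory is already realised by an `(n + 2)`-valued
assignment (`exists_finAssignment`), so that tautologies of `𝔾ₙ₊₂` are tautologies of `𝔾_∞`.
-/

namespace GodelLogic

variable {n : ℕ}

-- The order and lattice operations of the Lindenbaum algebra are taken from its Heyting algebra
-- structure, so that the general lemmas apply syntactically.
attribute [-instance] instMaxLindenbaum instMinLindenbaum instHImpLindenbaum instLELindenbaum
  instTopLindenbaum instBotLindenbaum instComplLindenbaum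

/-! ### Evaluation of formulas in Gödel chains -/

section Eval

variable {A B : Type*} [LinearOrder A] [BoundedOrder A] [LinearOrder B] [BoundedOrder B]

/-- The value of a formula in the bounded chain `A` with the Gödel operations, when `Xᵢ` has the
value `f i`. -/
def eval (f : Fin n → A) : Form n → A
  | .var i => f i
  | .bot => ⊥
  | .top => ⊤
  | .neg α => if eval f α ≤ ⊥ then ⊤ else ⊥
  | .and α β => min (eval f α) (eval f β)
  | .or α β => max (eval f α) (eval f β)
  | .imp α β => if eval f α ≤ eval f β then ⊤ else eval f β

/-- Residuation: implication is right adjoint to conjunction. -/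
theorem le_eval_imp_iff (f : Fin n → A) (c : A) (α β : Form n) :
    c ≤ eval f (.imp α β) ↔ min c (eval f α) ≤ eval f β := by
  simp only [eval]
  split_ifs with h
  · simp [h]
  · simp only [min_le_iff, h, or_false]

theorem eval_imp_eq_top_iff (f : Fin n → A) (α β : Form n) :
    eval f (.imp α β) = ⊤ ↔ eval f α ≤ eval f β := by
  rw [← top_le_iff, le_eval_imp_iff, min_eq_right le_top]

/-- Soundness of the calculus for every bounded chain. -/
theorem Derivable.eval_eq_top {α : Form n} (h : Derivable α) (f : Fin n → A) :
    eval f α = ⊤ := by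
  induction h with
  | mp _ _ h₁ h₂ => rwa [eval_imp_eq_top_iff, h₂, top_le_iff] at h₁
  | top_intro => rfl
  | prelinearity α β =>
    rcases le_total (eval f α) (eval f β) with h | h <;> simp [eval, h]
  | k α β => simp [eval_imp_eq_top_iff, le_eval_imp_iff]
  | s α β γ =>
    simp only [eval_imp_eq_top_iff, le_eval_imp_iff]
    simp only [eval]
    split_ifs <;> simp_all
    order
  | and_left α β => simp [eval]
  | and_right α β => simp [eval]
  | and_intro α β =>
    simp only [eval_imp_eq_top_iff, le_eval_imp_iff]
    exact le_rfl
  | or_left α β => simp [eval]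
  | or_right α β => simp [eval]
  | or_elim α β γ =>
    simp only [eval_imp_eq_top_iff, le_eval_imp_iff]
    simp only [eval]
    split_ifs <;> simp_all
  | bot_elim α => simp [eval]
  | neg_elim α => simp [eval]
  | neg_intro α => simp [eval]

theorem eval_le_of_derivable {α β : Form n} (h : Derivable (.imp α β)) (f : Fin n → A) :
    eval f α ≤ eval f β := (eval_imp_eq_top_iff f α β).1 (h.eval_eq_top f)

/-- A bound-preserving monotone map commutes with evaluation if it is strict wherever its value is
not `⊤`: such a map may only collapse an upper part of the chain to `⊤`. -/
theorem eval_map {h : A → B} (hm : Monotone h) (hbot : h ⊥ = ⊥) (htop : h ⊤ = ⊤)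
    (hlt : ∀ ⦃a b⦄, a < b → h a < h b ∨ h a = ⊤) (f : Fin n → A) (α : Form n) :
    eval (fun i => h (f i)) α = h (eval f α) := by
  have himp : ∀ a b : A, (if h a ≤ h b then ⊤ else h b) = h (if a ≤ b then ⊤ else b) := by
    intro a b
    by_cases hab : a ≤ b
    · rw [if_pos hab, if_pos (hm hab), htop]
    · rw [if_neg hab]
      rcases hlt (not_le.1 hab) with h' | h'
      · rw [if_neg (not_le.2 h')]
      · rw [h', ite_self]
  induction α with
  | var i => rfl
  | bot => exact hbot.symm
  | top => exact htop.symm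
  | neg α ih => simp only [eval, ih]; simpa only [hbot] using himp (eval f α) ⊥
  | and α β ih₁ ih₂ => simp only [eval, ih₁, ih₂, hm.map_min]
  | or α β ih₁ ih₂ => simp only [eval, ih₁, ih₂, hm.map_max]
  | imp α β ih₁ ih₂ => simp only [eval, ih₁, ih₂, himp]

theorem eval_mem (f : Fin n → A) (α : Form n) :
    eval f α = ⊥ ∨ eval f α = ⊤ ∨ ∃ i, eval f α = f i := by
  induction α with
  | var i => exact .inr (.inr ⟨i, rfl⟩)
  | bot => exact .inl rfl
  | top => exact .inr (.inl rfl)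
  | neg α ih => simp only [eval]; split_ifs <;> simp
  | and α β ih₁ ih₂ =>
    rcases min_choice (eval f α) (eval f β) with h | h <;> simp only [eval, h] <;> assumption
  | or α β ih₁ ih₂ =>
    rcases max_choice (eval f α) (eval f β) with h | h <;> simp only [eval, h] <;> assumption
  | imp α β ih₁ ih₂ =>
    simp only [eval]; split_ifs
    · exact .inr (.inl rfl)
    · exact ih₂

end Eval

theorem isAssignment_eval (f : Fin n → unitInterval) : IsAssignment (eval f) where
  map_and _ _ := rfl
  map_or _ _ := rfl
  map_imp α β := by simp only [eval]; rfl
  map_neg _ := rfl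
  map_bot := rfl
  map_top := rfl

theorem IsAssignment.eq_eval {μ : Form n → unitInterval} (h : IsAssignment μ) (α : Form n) :
    μ α = eval (fun i => μ (.var i)) α := by
  have himp : ∀ α β : Form n, μ (.imp α β) = if μ α ≤ μ β then ⊤ else μ β := h.map_imp
  have hbot : μ .bot = ⊥ := h.map_bot
  induction α with
  | var i => rfl
  | bot => exact h.map_bot
  | top => exact h.map_top
  | neg α ih => rw [h.map_neg, himp, hbot, ih]; rfl
  | and α β ih₁ ih₂ => rw [h.map_and, ih₁, ih₂]; rfl
  | or α β ih₁ ih₂ => rw [h.map_or, ih₁, ih₂]; rfl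
  | imp α β ih₁ ih₂ => rw [himp, ih₁, ih₂]; rfl

theorem cls_surjective : Function.Surjective (cls (n := n)) := Quotient.mk_surjective

/-! ### Evaluation on the Lindenbaum algebra, and prime filters -/

/-- The map induced by `eval f` on the Lindenbaum algebra; it is well defined by soundness. -/
def evalL {A : Type*} [LinearOrder A] [BoundedOrder A] (f : Fin n → A) : Lindenbaum n → A :=
  Quotient.lift (eval f) fun _ _ h =>
    le_antisymm (eval_le_of_derivable h.1 f) (eval_le_of_derivable h.2 f)

section EvalL

variable {A : Type*} [LinearOrder A] [BoundedOrder A] (f : Fin n → A)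

@[simp] theorem evalL_cls (α : Form n) : evalL f (cls α) = eval f α := rfl

theorem evalL_inf (a b : Lindenbaum n) : evalL f (a ⊓ b) = min (evalL f a) (evalL f b) := by
  obtain ⟨α, rfl⟩ := cls_surjective a
  obtain ⟨β, rfl⟩ := cls_surjective b
  rfl

theorem evalL_sup (a b : Lindenbaum n) : evalL f (a ⊔ b) = max (evalL f a) (evalL f b) := by
  obtain ⟨α, rfl⟩ := cls_surjective a
  obtain ⟨β, rfl⟩ := cls_surjective b
  rfl

theorem evalL_himp_eq_top_iff (a b : Lindenbaum n) :
    evalL f (a ⇨ b) = ⊤ ↔ evalL f a ≤ evalL f b := by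
  obtain ⟨α, rfl⟩ := cls_surjective a
  obtain ⟨β, rfl⟩ := cls_surjective b
  exact eval_imp_eq_top_iff f α β

theorem monotone_evalL : Monotone (evalL f) := by
  rintro ⟨α⟩ ⟨β⟩ h
  exact eval_le_of_derivable h f

end EvalL

theorem himp_sup_himp (a b : Lindenbaum n) : (a ⇨ b) ⊔ (b ⇨ a) = ⊤ := by
  obtain ⟨α, rfl⟩ := cls_surjective a
  obtain ⟨β, rfl⟩ := cls_surjective b
  exact top_le_iff.1 (Derivable.const (Derivable.prelinearity α β))

/-- `F` is a proper prime filter of the bounded lattice `L`. -/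
structure IsPrimeFilter {L : Type*} [Lattice L] [BoundedOrder L] (F : Set L) : Prop where
  top_mem : ⊤ ∈ F
  bot_notMem : ⊥ ∉ F
  inf_mem : ∀ {a b}, a ∈ F → b ∈ F → a ⊓ b ∈ F
  mem_of_le : ∀ {a b}, a ∈ F → a ≤ b → b ∈ F
  mem_or_mem : ∀ {a b}, a ⊔ b ∈ F → a ∈ F ∨ b ∈ F

theorem exists_isPrimeFilter {L : Type*} [DistribLattice L] [BoundedOrder L] {a b : L}
    (h : ¬ a ≤ b) : ∃ F : Set L, IsPrimeFilter F ∧ a ∈ F ∧ b ∉ F := by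
  obtain ⟨J, hJ, hb, hd⟩ := DistribLattice.prime_ideal_of_disjoint_filter_ideal
    (F := Order.PFilter.principal a) (I := Order.Ideal.principal b) (by
      rw [Set.disjoint_left]
      intro x hx hx'
      exact h (le_trans (Order.PFilter.mem_principal.1 hx) (Order.Ideal.mem_principal.1 hx')))
  have haJ : a ∉ J := Set.disjoint_left.1 hd (Order.PFilter.mem_principal.2 le_rfl)
  refine ⟨(J : Set L)ᶜ, ⟨fun ht => haJ (J.lower le_top ht), fun hb' => hb' J.bot_mem,
    fun ha hb hab => ?_, fun ha hab hb => ha (J.lower hab hb), fun hab => ?_⟩, haJ,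
    fun hb' => hb' (hb (Order.Ideal.mem_principal.2 le_rfl))⟩
  · exact (hJ.mem_or_mem hab).elim ha hb
  · by_contra hc
    push Not at hc
    exact hab (J.sup_mem (by simpa using hc.1) (by simpa using hc.2))

theorem isPrimeFilter_le_evalL {A : Type*} [LinearOrder A] [BoundedOrder A] (f : Fin n → A)
    {t : A} (ht : ⊥ < t) : IsPrimeFilter {a | t ≤ evalL f a} where
  top_mem := le_top
  bot_notMem := fun h => (lt_of_lt_of_le ht h).ne rfl
  inf_mem := fun ha hb => by
    rw [Set.mem_ofPred_eq, evalL_inf]; exact le_min ha hb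
  mem_of_le := fun ha hab => le_trans ha (monotone_evalL f hab)
  mem_or_mem := fun h => by
    rwa [Set.mem_ofPred_eq, evalL_sup, le_max_iff] at h

/-! ### Finiteness, and prime filters as evaluations -/

/-- Every prime filter `F` of the Lindenbaum algebra is the theory of an evaluation onto a finite
chain `0 < ⋯ < M`. The chain is the quotient by `F`, which is linear by prelinearity; it consists of
`⊥`, `⊤`, and the classes of the variables, so that `M ≤ n + 1`. -/
theorem exists_eval_of_isPrimeFilter {F : Set (Lindenbaum n)} (hF : IsPrimeFilter F) :
    ∃ M, 1 ≤ M ∧ M ≤ n + 1 ∧ ∃ f : Fin n → Fin (M + 1),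
      Function.Surjective (eval f) ∧ ∀ a, a ∈ F ↔ evalL f a = ⊤ := by
  classical
  -- The quotient by `F` is realised as a chain of sets: `a` goes to the set of elements that are
  -- below `a` modulo `F`.
  let below (a : Lindenbaum n) : Set (Lindenbaum n) := {b | b ⇨ a ∈ F}
  have hbelow : ∀ a b, below a ≤ below b ↔ a ⇨ b ∈ F := fun a b =>
    ⟨fun h => h (show a ⇨ a ∈ F by rw [himp_self]; exact hF.top_mem),
      fun h c hc => hF.mem_of_le (hF.inf_mem hc h) (himp_triangle c a b)⟩
  let A := Set.range below
  have htotal : ∀ x y : A, x ≤ y ∨ y ≤ x := by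
    rintro ⟨_, a, rfl⟩ ⟨_, b, rfl⟩
    exact (hF.mem_or_mem (by rw [himp_sup_himp]; exact hF.top_mem)).imp
      (hbelow a b).2 (hbelow b a).2
  let : LinearOrder A :=
    { (inferInstance : PartialOrder A) with
      le_total := htotal
      toDecidableLE := Classical.decRel _ }
  let q (a : Lindenbaum n) : A := ⟨below a, a, rfl⟩
  have hq : ∀ a b, q a ≤ q b ↔ a ⇨ b ∈ F := hbelow
  have hqm : Monotone q := fun a b h => (hq a b).2 (by
    rw [himp_eq_top_iff.2 h]; exact hF.top_mem)
  have hqs : Function.Surjective q := by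
    rintro ⟨_, a, rfl⟩
    exact ⟨a, rfl⟩
  let : BoundedOrder A :=
    { top := q ⊤
      bot := q ⊥
      le_top := fun x => by obtain ⟨a, rfl⟩ := hqs x; exact hqm le_top
      bot_le := fun x => by obtain ⟨a, rfl⟩ := hqs x; exact hqm bot_le }
  have htop : ∀ a, q a = ⊤ ↔ a ∈ F := fun a => by
    rw [← top_le_iff, show (⊤ : A) = q ⊤ from rfl, hq, top_himp]
  have hmem : ∀ {a b}, q a ≤ q b → a ∈ F → b ∈ F := fun {a b} h ha =>
    hF.mem_of_le (hF.inf_mem ((hq a b).1 h) ha) himp_inf_le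
  have hinf : ∀ a b, q (a ⊓ b) = min (q a) (q b) := fun a b =>
    le_antisymm (le_min (hqm inf_le_left) (hqm inf_le_right)) (by
      rcases le_total (q a) (q b) with h | h
      · rw [min_eq_left h, hq, himp_inf_distrib, himp_self, top_inf_eq]
        exact (hq a b).1 h
      · rw [min_eq_right h, hq, himp_inf_distrib, himp_self, inf_top_eq]
        exact (hq b a).1 h)
  have hsup : ∀ a b, q (a ⊔ b) = max (q a) (q b) := fun a b =>
    le_antisymm (by
      rcases le_total (q a) (q b) with h | h
      · rw [max_eq_right h, hq, sup_himp_distrib, himp_self, inf_top_eq]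
        exact (hq a b).1 h
      · rw [max_eq_left h, hq, sup_himp_distrib, himp_self, top_inf_eq]
        exact (hq b a).1 h) (max_le (hqm le_sup_left) (hqm le_sup_right))
  have himp : ∀ a b, q (a ⇨ b) = if q a ≤ q b then ⊤ else q b := fun a b => by
    split_ifs with h
    · exact (htop _).2 ((hq a b).1 h)
    · refine le_antisymm ((hq _ _).2 ?_) (hqm le_himp)
      -- prelinearity for `a` and `a ⇨ b`, where `a ⇨ (a ⇨ b) = a ⇨ b` is not in `F`
      rcases hF.mem_or_mem (a := a ⇨ (a ⇨ b)) (b := (a ⇨ b) ⇨ a)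
        (by rw [himp_sup_himp]; exact hF.top_mem) with h' | h'
      · rw [himp_idem] at h'
        exact absurd ((hq a b).2 h') h
      · have : ((a ⇨ b) ⇨ a) ≤ (a ⇨ b) ⇨ b := by
          rw [le_himp_iff, inf_comm]
          calc (a ⇨ b) ⊓ ((a ⇨ b) ⇨ a) ≤ (a ⇨ b) ⊓ a :=
                le_inf inf_le_left (by rw [inf_comm]; exact himp_inf_le)
            _ ≤ b := himp_inf_le
        exact hF.mem_of_le h' this
  have hom : ∀ α, q (cls α) = eval (fun i => q (cls (.var i))) α := by
    intro α
    induction α with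
    | var i => rfl
    | bot => rfl
    | top => rfl
    | neg α ih =>
      have : cls (.neg α) = cls α ⇨ ⊥ := (himp_bot (cls α)).symm
      rw [this, himp, ih]; rfl
    | and α β ih₁ ih₂ =>
      have : cls (.and α β) = cls α ⊓ cls β := rfl
      rw [this, hinf, ih₁, ih₂]; rfl
    | or α β ih₁ ih₂ =>
      have : cls (.or α β) = cls α ⊔ cls β := rfl
      rw [this, hsup, ih₁, ih₂]; rfl
    | imp α β ih₁ ih₂ =>
      have : cls (.imp α β) = cls α ⇨ cls β := rfl
      rw [this, himp, ih₁, ih₂]; rfl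
  let points : Option (Option (Fin n)) → A
    | none => ⊥
    | some none => ⊤
    | some (some i) => q (cls (.var i))
  have hpoints : Function.Surjective points := by
    intro x
    obtain ⟨a, rfl⟩ := hqs x
    obtain ⟨α, rfl⟩ := cls_surjective a
    rw [hom]
    rcases eval_mem (fun i => q (cls (.var i))) α with h | h | ⟨i, h⟩
    · exact ⟨none, h.symm⟩
    · exact ⟨some none, h.symm⟩
    · exact ⟨some (some i), h.symm⟩
  have : Fintype A := Fintype.ofSurjective points hpoints
  have hbt : (⊥ : A) ≠ ⊤ := fun h => hF.bot_notMem ((htop _).1 h)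
  have hcard : 1 < Fintype.card A := Fintype.one_lt_card_iff.2 ⟨_, _, hbt⟩
  have hcard' : Fintype.card A ≤ n + 2 := by
    simpa using Fintype.card_le_of_surjective points hpoints
  obtain ⟨M, hM⟩ : ∃ M, Fintype.card A = M + 1 := ⟨Fintype.card A - 1, by omega⟩
  let e : A ≃o Fin (M + 1) := (Fintype.orderIsoFinOfCardEq A hM).symm
  have he : ∀ α, eval (fun i => e (q (cls (.var i)))) α = e (q (cls α)) := fun α => by
    rw [hom]
    exact eval_map e.monotone e.map_bot e.map_top (fun a b h => .inl (e.strictMono h)) _ α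
  refine ⟨M, by omega, by omega, fun i => e (q (cls (.var i))), fun x => ?_, fun a => ?_⟩
  · obtain ⟨a, ha⟩ := hqs (e.symm x)
    obtain ⟨α, rfl⟩ := cls_surjective a
    exact ⟨α, by rw [he, ha, e.apply_symm_apply]⟩
  · obtain ⟨α, rfl⟩ := cls_surjective a
    rw [evalL_cls, he, map_eq_top_iff, htop]

/-- An element is determined by its values in the chains with at most `n + 2` elements. -/
instance : Finite (Lindenbaum n) := by
  refine Finite.of_injective (β := ∀ M : Fin (n + 2), (Fin n → Fin (M + 1)) → Fin (M + 1))
    (fun a M f => evalL f a) fun a b hab => ?_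
  have key : ∀ {a b : Lindenbaum n},
      (fun (M : Fin (n + 2)) (f : Fin n → Fin (M + 1)) => evalL f a) = (fun M f => evalL f b) →
      a ≤ b := by
    intro a b hab
    by_contra h
    obtain ⟨F, hF, ha, hb⟩ := exists_isPrimeFilter h
    obtain ⟨M, -, hM, f, -, hf⟩ := exists_eval_of_isPrimeFilter hF
    have := congrFun (congrFun hab ⟨M, by omega⟩) f
    exact hb ((hf b).2 (this ▸ (hf a).1 ha))
  exact le_antisymm (key hab) (key hab.symm)

theorem exists_supIrred_of_isPrimeFilter {L : Type*} [Lattice L] [BoundedOrder L] [Finite L]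
    {F : Set L} (hF : IsPrimeFilter F) : ∃ g : L, SupIrred g ∧ ∀ a, a ∈ F ↔ g ≤ a := by
  obtain ⟨g, hg⟩ := Set.toFinite F |>.exists_minimal ⟨⊤, hF.top_mem⟩
  have hle : ∀ a, a ∈ F ↔ g ≤ a := fun a =>
    ⟨fun ha => (hg.le_of_le (hF.inf_mem hg.prop ha) inf_le_left).trans inf_le_right,
      fun h => hF.mem_of_le hg.prop h⟩
  refine ⟨g, ⟨fun h => hF.bot_notMem ((hle _).2 (h bot_le)), fun {a b} hab => ?_⟩, hle⟩
  rcases hF.mem_or_mem (hab ▸ hg.prop) with h | h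
  · exact .inl (le_antisymm (hab ▸ le_sup_left) ((hle _).1 h))
  · exact .inr (le_antisymm (hab ▸ le_sup_right) ((hle _).1 h))

theorem isPrimeFilter_Ici_of_supIrred {L : Type*} [DistribLattice L] [BoundedOrder L] {g : L}
    (hg : SupIrred g) : IsPrimeFilter (Set.Ici g) where
  top_mem := le_top
  bot_notMem := fun h => hg.1 fun _ _ => le_trans h bot_le
  inf_mem := le_inf
  mem_of_le := le_trans
  mem_or_mem := fun h => hg.supPrime.2 h

/-! ### Valuations and heights -/

theorem IsValuation.ext_of_supIrred {L : Type*} [Lattice L] [OrderBot L] [Finite L] {μ ν : L → ℝ}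
    (hμ : IsValuation μ) (hν : IsValuation ν) (hbot : μ ⊥ = ν ⊥)
    (h : ∀ g, SupIrred g → μ g = ν g) : μ = ν := by
  funext x
  induction x using WellFoundedLT.induction with
  | ind x ih =>
    by_cases hx : SupIrred x
    · exact h x hx
    · rcases not_supIrred.1 hx with hx | ⟨a, b, rfl, ha, hb⟩
      · rw [hx.eq_bot, hbot]
      · have h₁ := hμ a b
        have h₂ := hν a b
        rw [ih a ha, ih b hb, ih (a ⊓ b) (lt_of_le_of_lt inf_le_left ha)] at h₁
        linarith

/-- If the prime filter generated by `g` is the theory of an evaluation onto the chain `0 < ⋯ < M`,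
then `g` has height `M`: the join-irreducible elements below `g` are the generators of the filters
`{a | t ≤ evalL f a}` for `1 ≤ t ≤ M`, and they increase with `t`. -/
theorem height_eq {g : Lindenbaum n} (hg : SupIrred g) {M : ℕ}
    {f : Fin n → Fin (M + 1)} (hM : 1 ≤ M) (hs : Function.Surjective (eval f))
    (hf : ∀ a, g ≤ a ↔ evalL f a = ⊤) : height (⟨g, hg⟩ : {x : Lindenbaum n // SupIrred x}) = M := by
  -- Below `g` the evaluation is strictly monotone, as `evalL f b ≤ evalL f a` gives `g ≤ b ⇨ a`.
  have hlt : ∀ {a b : Lindenbaum n}, a < b → b ≤ g → evalL f a < evalL f b := by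
    intro a b hab hb
    refine lt_of_le_of_ne (monotone_evalL f hab.le) fun he => hab.not_ge ?_
    have : g ≤ b ⇨ a := (hf _).2 ((evalL_himp_eq_top_iff f b a).2 he.ge)
    calc b ≤ (b ⇨ a) ⊓ b := le_inf (hb.trans this) le_rfl
      _ ≤ a := himp_inf_le
  have hpos : ∀ {a : Lindenbaum n}, SupIrred a → a ≤ g → 0 < (evalL f a).val := fun {a} ha hag => by
    have := Fin.lt_def.1 (hlt (bot_lt_iff_ne_bot.2 ha.ne_bot) hag)
    omega
  have upper : ∀ (m : ℕ) (x : {x : Lindenbaum n // SupIrred x}), x.1 ≤ g →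
      (evalL f x.1).val ≤ m + 1 → Order.height x ≤ m := by
    intro m
    induction m with
    | zero =>
      intro x hx hxm
      refine Order.height_le_coe_iff.2 fun y hy => ?_
      have h₁ := hpos y.2 (le_trans (le_of_lt (show y.1 < x.1 from hy)) hx)
      have h₂ := Fin.lt_def.1 (hlt hy hx)
      omega
    | succ m ih =>
      intro x hx hxm
      refine Order.height_le_coe_iff.2 fun y hy => ?_
      have h₂ := Fin.lt_def.1 (hlt hy hx)
      refine lt_of_le_of_lt (ih y (le_trans (le_of_lt (show y.1 < x.1 from hy)) hx) (by omega)) ?_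
      exact_mod_cast Nat.lt_succ_self m
  have lower : ∀ (m : ℕ) (hm : m < M) (x : {x : Lindenbaum n // SupIrred x}),
      (∀ a, x.1 ≤ a ↔ (⟨m + 1, by omega⟩ : Fin (M + 1)) ≤ evalL f a) → m ≤ Order.height x := by
    intro m
    induction m with
    | zero => intro _ x _; exact zero_le
    | succ m ih =>
      intro hm x hx
      obtain ⟨y, hy, hya⟩ := exists_supIrred_of_isPrimeFilter
        (isPrimeFilter_le_evalL f (t := (⟨m + 1, by omega⟩ : Fin (M + 1)))
          (Fin.lt_def.2 (Nat.succ_pos m)))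
      have hyx : (⟨y, hy⟩ : {x : Lindenbaum n // SupIrred x}) < x := by
        refine lt_of_le_not_ge ?_ fun h => ?_
        · refine (hya _).1 (le_trans (Fin.le_def.2 ?_) ((hx _).1 le_rfl))
          exact Nat.le_succ _
        · obtain ⟨α, hα⟩ := hs ⟨m + 1, by omega⟩
          have h₁ : y ≤ cls α := (hya _).1 (by simp [hα])
          have h₂ := (hx _).1 (le_trans h h₁)
          simp [hα] at h₂
      push_cast
      exact (add_le_add_left (ih (by omega) ⟨y, hy⟩ fun a => (hya a).symm) 1).trans
        (Order.height_add_one_le hyx)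
  obtain ⟨m, rfl⟩ : ∃ m, M = m + 1 := ⟨M - 1, by omega⟩
  have h₁ := upper m ⟨g, hg⟩ le_rfl (Fin.is_le _)
  have h₂ := lower m (Nat.lt_succ_self m) ⟨g, hg⟩ fun a => by
    rw [hf, ← top_le_iff]; rfl
  rw [height, le_antisymm h₁ h₂]
  push_cast; rfl

/-! ### `n`-equivalence is equality of theories -/

theorem IsAssignment.eq_one_iff {μ : Form n → unitInterval} (h : IsAssignment μ) (α : Form n) :
    μ α = 1 ↔ evalL (fun i => μ (.var i)) (cls α) = ⊤ := by
  rw [evalL_cls, ← h.eq_eval]; rfl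

theorem IsAssignment.imp_eq_one_iff {μ : Form n → unitInterval} (h : IsAssignment μ)
    (α β : Form n) : μ (.imp α β) = 1 ↔ μ α ≤ μ β := by
  rw [h.eq_eval, h.eq_eval α, h.eq_eval β]
  exact eval_imp_eq_top_iff _ α β

theorem sameOrder_of_eq_one_iff {μ ν : Form n → unitInterval} (hμ : IsAssignment μ)
    (hν : IsAssignment ν) (h : ∀ α, μ α = 1 ↔ ν α = 1) : SameOrder μ ν := by
  have hlt : ∀ α β, μ α < μ β ↔ ν α < ν β := fun α β => by
    rw [← not_le, ← not_le, ← hμ.imp_eq_one_iff, ← hν.imp_eq_one_iff, h]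
  refine ⟨fun i => ?_, fun i => ?_, fun i j => hlt _ _⟩
  · simpa only [hμ.map_bot, hν.map_bot] using hlt .bot (.var i)
  · simpa only [hμ.map_top, hν.map_top] using hlt (.var i) .top

theorem SameOrder.eq_one_iff {μ ν : Form n → unitInterval} (hμ : IsAssignment μ)
    (hν : IsAssignment ν) (h : SameOrder μ ν) (α : Form n) : μ α = 1 ↔ ν α = 1 := by
  -- Both assignments give every formula the value of the same element among `0`, `1`, and the
  -- variables.
  have key : ∀ α, (μ α = 0 ∧ ν α = 0) ∨ (μ α = 1 ∧ ν α = 1) ∨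
      ∃ i, μ α = μ (.var i) ∧ ν α = ν (.var i) := by
    have hle : ∀ {α β}, ((μ α = 0 ∧ ν α = 0) ∨ (μ α = 1 ∧ ν α = 1) ∨
          ∃ i, μ α = μ (.var i) ∧ ν α = ν (.var i)) →
        ((μ β = 0 ∧ ν β = 0) ∨ (μ β = 1 ∧ ν β = 1) ∨
          ∃ i, μ β = μ (.var i) ∧ ν β = ν (.var i)) → (μ α ≤ μ β ↔ ν α ≤ ν β) := by
      obtain ⟨h₀, h₁, h₂⟩ := h
      have nn : ∀ x : unitInterval, 0 ≤ x := unitInterval.nonneg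
      have n1 : ∀ x : unitInterval, x ≤ 1 := unitInterval.le_one
      rintro α β (⟨a, b⟩ | ⟨a, b⟩ | ⟨i, a, b⟩) (⟨c, d⟩ | ⟨c, d⟩ | ⟨j, c, d⟩) <;>
        rw [a, b, c, d]
      · simp [nn]
      · rw [← not_lt, ← not_lt, h₁]
      · rw [← not_lt, ← not_lt, h₀]
      · simp [n1]
      · rw [← not_lt, ← not_lt, h₂]
    intro α
    induction α with
    | var i => exact .inr (.inr ⟨i, rfl, rfl⟩)
    | bot => exact .inl ⟨hμ.map_bot, hν.map_bot⟩
    | top => exact .inr (.inl ⟨hμ.map_top, hν.map_top⟩)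
    | neg α ih =>
      have hb : (μ .bot = 0 ∧ ν .bot = 0) ∨ (μ .bot = 1 ∧ ν .bot = 1) ∨
        ∃ i, μ .bot = μ (.var i) ∧ ν .bot = ν (.var i) := .inl ⟨hμ.map_bot, hν.map_bot⟩
      rw [hμ.map_neg, hν.map_neg, hμ.map_imp, hν.map_imp]
      simp only [hle ih hb]
      split_ifs
      · exact .inr (.inl ⟨rfl, rfl⟩)
      · exact hb
    | and α β ih₁ ih₂ =>
      rw [hμ.map_and, hν.map_and, min_def, min_def]
      simp only [hle ih₁ ih₂]
      split_ifs <;> assumption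
    | or α β ih₁ ih₂ =>
      rw [hμ.map_or, hν.map_or, max_def, max_def]
      simp only [hle ih₁ ih₂]
      split_ifs <;> assumption
    | imp α β ih₁ ih₂ =>
      rw [hμ.map_imp, hν.map_imp]
      simp only [hle ih₁ ih₂]
      split_ifs
      · exact .inr (.inl ⟨rfl, rfl⟩)
      · exact ih₂
  rcases key α with ⟨a, b⟩ | ⟨a, b⟩ | ⟨i, a, b⟩
  · rw [a, b]
  · simp [a, b]
  · have h₁ := h.2.1 i
    rw [a, b]
    rw [lt_iff_le_and_ne, lt_iff_le_and_ne] at h₁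
    have n1 : ∀ x : unitInterval, x ≤ 1 := unitInterval.le_one
    simpa [n1, not_iff_not] using h₁

theorem nEquiv_iff {μ ν : Form n → unitInterval} (hμ : IsAssignment μ) (hν : IsAssignment ν) :
    NEquiv μ ν ↔ ∀ α, μ α = 1 ↔ ν α = 1 :=
  ⟨fun h => h.sameOrder.eq_one_iff hμ hν, fun h => (sameOrder_of_eq_one_iff hμ hν h).nEquiv⟩

/-! ### Truncated assignments -/

/-- The map that collapses the part `t ≤ j` of the chain `0 < ⋯ < M` to `1` and sends `j < t` to
`j / k`. The `min` only serves to stay in the unit interval without assuming `t ≤ k`. -/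
noncomputable def truncate (M k t : ℕ) (j : Fin (M + 1)) : unitInterval :=
  if t ≤ j then 1 else ⟨min (j / k) 1, le_min (by positivity) zero_le_one, min_le_right _ _⟩

section truncate

variable {M k t : ℕ}

theorem truncate_of_lt (htk : t ≤ k) {j : Fin (M + 1)} (h : (j : ℕ) < t) :
    (truncate M k t j : ℝ) = j / k ∧ (j / k : ℝ) < 1 := by
  have h1 : (j / k : ℝ) < 1 := by
    rw [div_lt_one (by exact_mod_cast (by omega : 0 < k))]
    exact_mod_cast (by omega : (j : ℕ) < k)
  refine ⟨?_, h1⟩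
  rw [truncate, if_neg (by omega)]
  exact min_eq_left h1.le

theorem truncate_of_le {j : Fin (M + 1)} (h : t ≤ j) : truncate M k t j = 1 := if_pos h

theorem truncate_eq_one_iff (htk : t ≤ k) {j : Fin (M + 1)} : truncate M k t j = 1 ↔ t ≤ j := by
  refine ⟨fun h => ?_, truncate_of_le⟩
  by_contra hc
  obtain ⟨h₁, h₂⟩ := truncate_of_lt htk (not_le.1 hc)
  rw [h, Set.Icc.coe_one] at h₁
  linarith

theorem truncate_mem (hk : 1 ≤ k) (htk : t ≤ k) (j : Fin (M + 1)) :
    (truncate M k t j : ℝ) ∈ truthValues (k + 1) := by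
  have hk' : (k : ℝ) ≠ 0 := by positivity
  rcases le_or_gt t j with h | h
  · exact ⟨k, le_rfl, by rw [truncate_of_le h]; simp [hk']⟩
  · exact ⟨j, by simp; omega, by rw [(truncate_of_lt htk h).1]; simp⟩

theorem eval_truncate (ht : 1 ≤ t) (htM : t ≤ M) (htk : t ≤ k) (f : Fin n → Fin (M + 1))
    (α : Form n) : eval (fun i => truncate M k t (f i)) α = truncate M k t (eval f α) := by
  have hlt : ∀ ⦃a b : Fin (M + 1)⦄, a < b →
      truncate M k t a < truncate M k t b ∨ truncate M k t a = ⊤ := by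
    intro a b hab
    rcases le_or_gt t a with ha | ha
    · exact .inr (truncate_of_le ha)
    · left
      rcases le_or_gt t b with hb | hb
      · rw [truncate_of_le hb, ← Subtype.coe_lt_coe, (truncate_of_lt htk ha).1]
        exact (truncate_of_lt htk ha).2
      · rw [← Subtype.coe_lt_coe, (truncate_of_lt htk ha).1, (truncate_of_lt htk hb).1]
        have : (0 : ℝ) < k := by exact_mod_cast (by omega : 0 < k)
        gcongr
        exact hab
  refine eval_map (fun a b hab => ?_) ?_ (truncate_of_le htM) hlt f α
  · rcases hab.lt_or_eq with h | rfl
    · rcases hlt h with h' | h'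
      · exact h'.le
      · have : t ≤ a := (truncate_eq_one_iff htk).1 h'
        rw [h', truncate_of_le (this.trans hab)]; rfl
    · exact le_rfl
  · apply Subtype.ext
    rw [(truncate_of_lt htk (j := ⊥) ht).1]
    change ((0 : ℕ) : ℝ) / _ = 0
    simp

end truncate

/-- The `(k + 1)`-valued assignment whose theory is `{α | t ≤ eval f α}`. -/
noncomputable def truncAssignment {M k t : ℕ} (f : Fin n → Fin (M + 1)) (hk : 1 ≤ k) (ht : 1 ≤ t)
    (htM : t ≤ M) (htk : t ≤ k) : FinAssignment n (k + 1) :=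
  ⟨eval fun i => truncate M k t (f i), isAssignment_eval _, fun α => by
    rw [eval_truncate ht htM htk]; exact truncate_mem hk htk _⟩

theorem truncAssignment_eq_one_iff {M k t : ℕ} (f : Fin n → Fin (M + 1)) (hk : 1 ≤ k) (ht : 1 ≤ t)
    (htM : t ≤ M) (htk : t ≤ k) (α : Form n) :
    (truncAssignment f hk ht htM htk).1 α = 1 ↔ t ≤ eval f α := by
  rw [← truncate_eq_one_iff htk, ← eval_truncate ht htM htk]; rfl

/-- If the theory of a `(k + 1)`-valued assignment is `{α | t ≤ eval f α}`, then it takes at least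
`t + 1` values, one for each of `0, …, t`; hence `t ≤ k`. -/
theorem le_of_eq_one_iff {M k t : ℕ} {f : Fin n → Fin (M + 1)}
    (hs : Function.Surjective (eval f)) (htM : t ≤ M) (ν : FinAssignment n (k + 1))
    (h : ∀ α, ν.1 α = 1 ↔ t ≤ eval f α) : t ≤ k := by
  choose α hα using hs
  choose i hi hνi using ν.2.2
  have hmono : ∀ a b : Fin (M + 1), a < b → a < t → i (α a) < i (α b) := by
    intro a b hab hat
    have h₁ : ν.1 (α a) < ν.1 (α b) := by
      rw [← not_le, ← ν.2.1.imp_eq_one_iff, h]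
      simp only [eval, hα, not_le.2 hab, if_false]
      omega
    rw [← Subtype.coe_lt_coe, hνi, hνi] at h₁
    have : (0 : ℝ) ≤ ((k + 1 - 1 : ℕ) : ℝ) := Nat.cast_nonneg _
    by_contra hc
    exact absurd h₁ (not_lt.2 (by gcongr; exact not_lt.1 hc))
  have hinj : Function.Injective fun j : Fin (t + 1) =>
      (⟨i (α ⟨j, by omega⟩), by have := hi (α ⟨j, by omega⟩); omega⟩ : Fin (k + 1)) := by
    intro a b hab
    have hab' := Fin.mk.inj_iff.1 hab
    rcases lt_trichotomy a b with hl | hl | hl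
    · exact absurd hab' (hmono ⟨a, by omega⟩ ⟨b, by omega⟩ hl (by simp; omega)).ne
    · exact hl
    · exact absurd hab' (hmono ⟨b, by omega⟩ ⟨a, by omega⟩ hl (by simp; omega)).ne'
  have := Fintype.card_le_of_injective _ hinj
  simpa using this

/-! ### The generalised characteristic counts classes of models -/

theorem isPrimeFilter_theory (μ : Form n → unitInterval) :
    IsPrimeFilter {a | evalL (fun i => μ (.var i)) a = ⊤} := by
  have := isPrimeFilter_le_evalL (fun i => μ (.var i)) (t := ⊤) bot_lt_top
  simpa only [top_le_iff] using this

theorem mk_mem_modelClasses_iff {m : ℕ} (μ : FinAssignment n m) (φ : Form n) :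
    Quotient.mk (nEquivSetoid n m) μ ∈ modelClasses m φ ↔ μ.1 φ = 1 :=
  ⟨fun ⟨ν, hν, h⟩ => ((nEquiv_iff ν.2.1 μ.2.1).1 (Quotient.exact h) φ).1 hν, fun h => ⟨μ, h, rfl⟩⟩

theorem mk_eq_mk_iff {m : ℕ} (μ ν : FinAssignment n m) :
    Quotient.mk (nEquivSetoid n m) μ = Quotient.mk (nEquivSetoid n m) ν ↔
      ∀ α, μ.1 α = 1 ↔ ν.1 α = 1 :=
  Quotient.eq.trans (nEquiv_iff μ.2.1 ν.2.1)

/-- A class of assignments is determined by its theory, a subset of the finite Lindenbaum algebra. -/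
instance (m : ℕ) : Finite (Quotient (nEquivSetoid n m)) := by
  refine Finite.of_injective
    (fun c => {a : Lindenbaum n | ∃ α, cls α = a ∧ c ∈ modelClasses m α}) ?_
  rintro ⟨μ⟩ ⟨ν⟩ h
  have hm : ∀ (μ : FinAssignment n m) (α : Form n),
      (cls α ∈ {a : Lindenbaum n | ∃ β, cls β = a ∧
        Quotient.mk (nEquivSetoid n m) μ ∈ modelClasses m β}) ↔ μ.1 α = 1 := by
    refine fun μ α => ⟨?_, fun h => ⟨α, rfl, (mk_mem_modelClasses_iff μ α).2 h⟩⟩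
    rintro ⟨β, hβ, h⟩
    rw [mk_mem_modelClasses_iff, μ.2.1.eq_one_iff, hβ] at h
    exact (μ.2.1.eq_one_iff α).2 h
  exact (mk_eq_mk_iff μ ν).2 fun α => by
    rw [← hm μ, ← hm ν]
    exact Iff.of_eq (congrArg (cls α ∈ ·) h)

/-- The number of `n`-equivalence classes of `(k + 1)`-valued models, as a function on the Lindenbaum
algebra. -/
noncomputable def countModels (k : ℕ) : Lindenbaum n → ℝ :=
  Quotient.lift (fun φ => ((modelClasses (k + 1) φ).ncard : ℝ)) fun φ ψ h => by
    have : modelClasses (k + 1) φ = modelClasses (k + 1) ψ := by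
      ext ⟨μ⟩
      have hc : cls φ = cls ψ := Quotient.sound h
      exact ((mk_mem_modelClasses_iff μ φ).trans (by
        rw [μ.2.1.eq_one_iff, μ.2.1.eq_one_iff, hc])).trans (mk_mem_modelClasses_iff μ ψ).symm
    simp only [this]

theorem countModels_cls (k : ℕ) (φ : Form n) :
    countModels k (cls φ) = (modelClasses (k + 1) φ).ncard := rfl

theorem isValuation_countModels (k : ℕ) : IsValuation (countModels (n := n) k) := by
  intro x y
  obtain ⟨α, rfl⟩ := cls_surjective x
  obtain ⟨β, rfl⟩ := cls_surjective y
  change countModels k (cls α) + countModels k (cls β) =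
    countModels k (cls (.or α β)) + countModels k (cls (.and α β))
  simp only [countModels_cls]
  have hor : modelClasses (k + 1) (.or α β) = modelClasses (k + 1) α ∪ modelClasses (k + 1) β := by
    ext ⟨μ⟩
    refine (mk_mem_modelClasses_iff μ _).trans (Iff.trans ?_
      (or_congr (mk_mem_modelClasses_iff μ α) (mk_mem_modelClasses_iff μ β)).symm)
    rw [μ.2.1.map_or]
    exact max_eq_top
  have hand : modelClasses (k + 1) (.and α β) =
      modelClasses (k + 1) α ∩ modelClasses (k + 1) β := by
    ext ⟨μ⟩
    refine (mk_mem_modelClasses_iff μ _).trans (Iff.trans ?_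
      (and_congr (mk_mem_modelClasses_iff μ α) (mk_mem_modelClasses_iff μ β)).symm)
    rw [μ.2.1.map_and]
    exact min_eq_top
  rw [hor, hand]
  exact_mod_cast (Set.ncard_union_add_ncard_inter _ _).symm

/-- If `cls φ` generates the theory of an evaluation onto the chain `0 < ⋯ < M`, then the
`(k + 1)`-valued models of `φ` are, up to `n`-equivalence, the truncations of that evaluation at the
thresholds `1 ≤ t ≤ min M k`. -/
theorem ncard_modelClasses_of_supIrred {φ : Form n} {M k : ℕ} {f : Fin n → Fin (M + 1)}
    (hk : 1 ≤ k) (hs : Function.Surjective (eval f))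
    (hf : ∀ a, cls φ ≤ a ↔ evalL f a = ⊤) :
    (modelClasses (k + 1) φ).ncard = min M k := by
  have hφ : eval f φ = ⊤ := (hf _).1 le_rfl
  have hbij : Function.Bijective fun t : Fin (min M k) =>
      (⟨Quotient.mk _ (truncAssignment f hk (Nat.le_add_left 1 t.1)
        (show t.1 + 1 ≤ M by omega) (show t.1 + 1 ≤ k by omega)),
        (mk_mem_modelClasses_iff _ φ).2 ((truncAssignment_eq_one_iff ..).2 (by
          rw [hφ]; exact (show t.1 + 1 ≤ M by omega)))⟩ : modelClasses (k + 1) φ) := by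
    refine ⟨fun t s hts => ?_, ?_⟩
    · have hts' := (mk_eq_mk_iff _ _).1 (Subtype.ext_iff.1 hts)
      simp only [truncAssignment_eq_one_iff] at hts'
      obtain ⟨α, hα⟩ := hs ⟨t + 1, by omega⟩
      obtain ⟨β, hβ⟩ := hs ⟨s + 1, by omega⟩
      have h₁ := hts' α
      have h₂ := hts' β
      simp only [hα, hβ, le_refl, true_iff, iff_true] at h₁ h₂
      omega
    · rintro ⟨⟨ν⟩, hν⟩
      have hν1 : ν.1 φ = 1 := (mk_mem_modelClasses_iff ν φ).1 hν
      obtain ⟨g, hg, hga⟩ := exists_supIrred_of_isPrimeFilter (isPrimeFilter_theory ν.1)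
      have hgφ : g ≤ cls φ := (hga _).1 ((ν.2.1.eq_one_iff φ).1 hν1)
      -- the threshold of `ν` is the value of the generator of its theory
      obtain ⟨t, ht⟩ : ∃ t : ℕ, t = (evalL f g).val := ⟨_, rfl⟩
      have hle : ∀ a, g ≤ a ↔ t ≤ evalL f a := fun a => by
        rw [ht]
        refine ⟨fun h => monotone_evalL f h, fun h => ?_⟩
        have : cls φ ≤ g ⇨ a := (hf _).2 ((evalL_himp_eq_top_iff f g a).2 h)
        calc g ≤ (g ⇨ a) ⊓ g := le_inf (hgφ.trans this) le_rfl
          _ ≤ a := himp_inf_le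
      have heq : ∀ α, ν.1 α = 1 ↔ t ≤ eval f α := fun α => by
        rw [ν.2.1.eq_one_iff, ← evalL_cls, ← hle]
        exact hga _
      have htM : t ≤ M := ht ▸ Fin.is_le _
      have htk : t ≤ k := le_of_eq_one_iff hs htM ν heq
      obtain _ | t := t
      · exact absurd (le_bot_iff.1 ((hle ⊥).2 (Nat.zero_le _))) hg.ne_bot
      · refine ⟨⟨t, by omega⟩, Subtype.ext ((mk_eq_mk_iff _ _).2 fun α => ?_)⟩
        rw [truncAssignment_eq_one_iff, heq]
  rw [← Nat.card_coe_set_eq, ← Nat.card_congr (Equiv.ofBijective _ hbij), Nat.card_fin]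

theorem isGenChar_countModels {k : ℕ} (hk : 1 ≤ k) : IsGenChar n k (countModels k) where
  valuation := isValuation_countModels k
  map_bot := by
    change countModels k (cls .bot) = 0
    rw [countModels_cls, Nat.cast_eq_zero, Set.ncard_eq_zero, Set.eq_empty_iff_forall_notMem]
    rintro ⟨μ⟩ h
    have := (mk_mem_modelClasses_iff μ _).1 h
    rw [μ.2.1.map_bot] at this
    exact zero_ne_one this
  map_supIrred := by
    rintro ⟨g, hg⟩
    obtain ⟨φ, rfl⟩ := cls_surjective g
    obtain ⟨M, hM, -, f, hs, hf⟩ := exists_eval_of_isPrimeFilter (isPrimeFilter_Ici_of_supIrred hg)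
    rw [height_eq hg hM hs hf, countModels_cls, ncard_modelClasses_of_supIrred hk hs hf]
    norm_cast

theorem existsUnique_isGenChar {k : ℕ} (hk : 1 ≤ k) :
    ∃! ν : Lindenbaum n → ℝ, IsGenChar n k ν :=
  ⟨countModels k, isGenChar_countModels hk, fun _ hν =>
    hν.valuation.ext_of_supIrred (isValuation_countModels k)
      (hν.map_bot.trans (isGenChar_countModels hk).map_bot.symm) fun g hg =>
      (hν.map_supIrred ⟨g, hg⟩).trans ((isGenChar_countModels hk).map_supIrred ⟨g, hg⟩).symm⟩

theorem chi_eq_ncard {k : ℕ} (hk : 1 ≤ k) (φ : Form n) :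
    chi k φ = (modelClasses (k + 1) φ).ncard := by
  have h : ∃ ν, IsGenChar n k ν := (existsUnique_isGenChar hk).exists
  rw [chi, genChar, dif_pos h,
    (existsUnique_isGenChar hk).unique h.choose_spec (isGenChar_countModels hk), countModels_cls]

/-! ### Tautologies -/

/-- Every assignment has the theory of an `(n + 2)`-valued one. -/
theorem exists_finAssignment {μ : Form n → unitInterval} (hμ : IsAssignment μ) :
    ∃ ν : FinAssignment n (n + 2), ∀ α, ν.1 α = 1 ↔ μ α = 1 := by
  obtain ⟨M, hM, hMn, f, hs, hf⟩ := exists_eval_of_isPrimeFilter (isPrimeFilter_theory μ)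
  refine ⟨truncAssignment f (k := n + 1) (by omega) hM le_rfl hMn, fun α => ?_⟩
  rw [truncAssignment_eq_one_iff, hμ.eq_one_iff]
  refine Iff.trans ?_ (hf (cls α)).symm
  rw [← top_le_iff]; rfl

theorem isTautology_iff (φ : Form n) : IsTautology φ ↔ IsFinTautology (n + 2) φ := by
  refine ⟨fun h μ => h _ μ.2.1, fun h μ hμ => ?_⟩
  obtain ⟨ν, hν⟩ := exists_finAssignment hμ
  exact (hν φ).1 (h ν)

theorem isFinTautology_iff (m : ℕ) (φ : Form n) :
    IsFinTautology m φ ↔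
      (modelClasses m φ).ncard = Nat.card (Quotient (nEquivSetoid n m)) := by
  rw [← Set.ncard_univ]
  constructor
  · intro h
    congr 1
    rw [Set.eq_univ_iff_forall]
    rintro ⟨μ⟩
    exact (mk_mem_modelClasses_iff μ φ).2 (h μ)
  · intro h μ
    rw [← mk_mem_modelClasses_iff, Set.eq_of_subset_of_ncard_le (Set.subset_univ _) h.ge]
    trivial

/-! ### Counting all classes -/

/-- The recursion for `T` holds without the case `l > m + 1`, where all summands vanish. -/
theorem T_add_two (m l : ℕ) :
    T m (l + 2) = ∑ i ∈ Finset.Icc 1 m, m.choose i * T (m - i) (l + 1) := by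
  rw [T]
  split_ifs with h
  · symm
    refine Finset.sum_eq_zero fun i hi => ?_
    rw [Finset.mem_Icc] at hi
    cases l with
    | zero => omega
    | succ l => rw [T, if_pos (by omega), mul_zero]
  · rfl

/-- Counting functions to `Fin (l + 1)` according to the fibre `s` over `0`: such a function is a
function from the complement of `s` to the positive values. The condition at the value `0` is
separated from those at the positive values; `R` says whether `0` has to be attained. -/
theorem card_fun_fiber_zero {ι : Type*} [Fintype ι] [DecidableEq ι] (l : ℕ) (R : Prop) [Decidable R]
    (Q : Fin l → Prop) :
    Nat.card {f : ι → Fin (l + 1) // (R → ∃ i, f i = 0) ∧ ∀ j, Q j → ∃ i, f i = j.succ} =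
      ∑ s : Finset ι, if R → s.Nonempty then
        Nat.card {g : {i // i ∉ s} → Fin l // ∀ j, Q j → ∃ i, g i = j} else 0 := by
  classical
  rw [← Finset.sum_filter, ← Finset.sum_subtype_eq_sum_filter]
  simp only [Finset.subtype_univ]
  rw [← Nat.card_sigma]
  symm
  refine Nat.card_congr (Equiv.ofBijective (fun x =>
    ⟨fun i => if h : i ∈ x.1.1 then 0 else (x.2.1 ⟨i, h⟩).succ, fun hR => ?_, fun j hj => ?_⟩)
    ⟨?_, ?_⟩)
  · obtain ⟨i, hi⟩ := x.1.2 hR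
    exact ⟨i, dif_pos hi⟩
  · obtain ⟨i, hi⟩ := x.2.2 j hj
    exact ⟨i.1, (dif_neg i.2).trans (congrArg Fin.succ hi)⟩
  · rintro ⟨⟨s, hs⟩, g, hg⟩ ⟨⟨s', hs'⟩, g', hg'⟩ h
    have h' := fun i => congrFun (Subtype.ext_iff.1 h) i
    simp only at h'
    have hss : s = s' := by
      ext i
      have := h' i
      by_cases h₁ : i ∈ s <;> by_cases h₂ : i ∈ s' <;> simp_all
      exact absurd this.symm (Fin.succ_ne_zero _)
    subst hss
    have hgg : g = g' := by
      funext i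
      simpa [dif_neg i.2] using h' i
    subst hgg
    rfl
  · rintro ⟨f, hf₀, hf⟩
    have hne : ∀ i : {i // i ∉ Finset.univ.filter (fun i => f i = 0)}, f i ≠ 0 := fun i => by
      simpa using i.2
    refine ⟨⟨⟨Finset.univ.filter (fun i => f i = 0), fun hR => ?_⟩,
      fun i => (f i).pred (hne i), fun j hj => ?_⟩, ?_⟩
    · obtain ⟨i, hi⟩ := hf₀ hR
      exact ⟨i, by simpa using hi⟩
    · obtain ⟨i, hi⟩ := hf j hj
      exact ⟨⟨i, by simp [hi]⟩, by simp [hi]⟩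
    · refine Subtype.ext (funext fun i => ?_)
      by_cases h : f i = 0 <;> simp [h]

/-- `T m (l + 1)` counts the functions from an `m`-element set to `{0, …, l}` that attain every value
except possibly the last. -/
theorem card_onto_init (l : ℕ) {ι : Type} [Fintype ι] :
    Nat.card {f : ι → Fin (l + 1) // ∀ j, j ≠ Fin.last l → ∃ i, f i = j} =
      T (Fintype.card ι) (l + 1) := by
  classical
  induction l generalizing ι with
  | zero =>
    have hT : T (Fintype.card ι) (0 + 1) = 1 := by rw [T]
    rw [hT, Nat.card_eq_one_iff_unique]
    exact ⟨⟨fun f g => Subtype.ext (funext fun i => Fin.ext (by omega))⟩,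
      ⟨⟨fun _ => 0, fun j hj => absurd (Fin.ext (by simp)) hj⟩⟩⟩
  | succ l ih =>
    have h := card_fun_fiber_zero (ι := ι) (l + 1) True (fun j => j ≠ Fin.last l)
    have hset : ∀ f : ι → Fin (l + 2), (∀ j, j ≠ Fin.last (l + 1) → ∃ i, f i = j) ↔
        (True → ∃ i, f i = 0) ∧ ∀ j : Fin (l + 1), j ≠ Fin.last l → ∃ i, f i = j.succ := by
      intro f
      rw [Fin.forall_fin_succ]
      refine and_congr ⟨fun h _ => h (Fin.last_pos.ne), fun h _ => h trivial⟩ ?_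
      simp only [ne_eq, ← Fin.succ_last, Fin.succ_inj]
    rw [Nat.card_congr (Equiv.subtypeEquivRight hset), h, T_add_two]
    simp only [ih, Fintype.card_subtype_compl, Fintype.card_coe, forall_const]
    have := Finset.sum_powerset_apply_card
      (fun i => if i = 0 then 0 else T (Fintype.card ι - i) (l + 1)) (x := (Finset.univ : Finset ι))
    rw [Finset.powerset_univ] at this
    have h2 : ∀ s : Finset ι, (if s.Nonempty then T (Fintype.card ι - s.card) (l + 1) else 0) =
        if s.card = 0 then 0 else T (Fintype.card ι - s.card) (l + 1) := fun s => by
      rcases s.eq_empty_or_nonempty with rfl | hs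
      · simp
      · rw [if_pos hs, if_neg hs.card_pos.ne']
    rw [Finset.sum_congr rfl fun s _ => h2 s, this, Finset.card_univ, Finset.sum_range_succ']
    simp only [if_true, Nat.succ_ne_zero, if_false, smul_eq_mul]
    rw [Finset.range_eq_Ico, Finset.sum_Ico_add' (fun i => (Fintype.card ι).choose i *
      T (Fintype.card ι - i) (l + 1)) 0 _ 1, zero_add]
    rfl

/-- The `i`-th summand of `P n k`, for `i = M + 1`, counts the functions to `{0, …, M + 1}` that attain
every value except possibly the first and the last. -/
theorem card_onto_interior (n M : ℕ) :
    Nat.card {f : Fin n → Fin (M + 2) // ∀ j, j ≠ 0 → j ≠ Fin.last (M + 1) → ∃ i, f i = j} =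
      ∑ j ∈ Finset.range (n + 1), n.choose j * T j (M + 1) := by
  have h := card_fun_fiber_zero (ι := Fin n) (M + 1) False (fun j => j ≠ Fin.last M)
  have hset : ∀ f : Fin n → Fin (M + 2), (∀ j, j ≠ 0 → j ≠ Fin.last (M + 1) → ∃ i, f i = j) ↔
      (False → ∃ i, f i = 0) ∧ ∀ j : Fin (M + 1), j ≠ Fin.last M → ∃ i, f i = j.succ := by
    intro f
    rw [Fin.forall_fin_succ]
    refine and_congr ⟨fun _ => False.elim, fun _ h => absurd rfl h⟩ ?_
    simp only [ne_eq, ← Fin.succ_last, Fin.succ_inj, Fin.succ_ne_zero, not_false_eq_true,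
      forall_const]
  rw [Nat.card_congr (Equiv.subtypeEquivRight hset), h]
  simp only [card_onto_init, Fintype.card_subtype_compl, Fintype.card_coe, Fintype.card_fin,
    false_imp_iff, if_true]
  have := Finset.sum_powerset_apply_card (fun i => T (n - i) (M + 1))
    (x := (Finset.univ : Finset (Fin n)))
  rw [Finset.powerset_univ] at this
  rw [this, Finset.card_univ, Fintype.card_fin, ← Finset.sum_range_reflect]
  refine Finset.sum_congr rfl fun j hj => ?_
  have hj' := Finset.mem_range.1 hj
  rw [smul_eq_mul, show n + 1 - 1 - j = n - j by omega, Nat.choose_symm (by omega),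
    show n - (n - j) = j by omega]

theorem surjective_eval_iff {M : ℕ} (f : Fin n → Fin (M + 1)) :
    Function.Surjective (eval f) ↔ ∀ j, j ≠ 0 → j ≠ Fin.last M → ∃ i, f i = j := by
  constructor
  · intro hs j h₀ h₁
    obtain ⟨α, rfl⟩ := hs j
    rcases eval_mem f α with h | h | ⟨i, h⟩
    · exact absurd h h₀
    · exact absurd h h₁
    · exact ⟨i, h.symm⟩
  · intro h j
    by_cases h₀ : j = 0
    · exact ⟨.bot, h₀.symm⟩
    by_cases h₁ : j = Fin.last M
    · exact ⟨.top, h₁.symm⟩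
    obtain ⟨i, hi⟩ := h j h₀ h₁
    exact ⟨.var i, hi⟩

/-- An evaluation onto an initial segment of `ℕ` is determined by its theory; this is one of the two
inequalities. -/
theorem eval_le_eval_of_eq_top_iff {M N : ℕ} {f : Fin n → Fin (M + 1)} {g : Fin n → Fin (N + 1)}
    (hf : Function.Surjective (eval f)) (h : ∀ α, eval f α = ⊤ ↔ eval g α = ⊤) (α : Form n) :
    (eval f α).val ≤ (eval g α).val := by
  have hlt : ∀ α β, eval f α < eval f β → eval g α < eval g β := fun α β => by
    rw [← not_le, ← not_le, ← eval_imp_eq_top_iff, ← eval_imp_eq_top_iff, h]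
    exact id
  have key : ∀ m α, (eval f α).val = m → m ≤ (eval g α).val := by
    intro m
    induction m with
    | zero => exact fun _ _ => Nat.zero_le _
    | succ m ih =>
      intro α hα
      obtain ⟨β, hβ⟩ := hf ⟨m, by omega⟩
      have h₁ := Fin.lt_def.1 (hlt β α (Fin.lt_def.2 (by rw [hβ, hα]; exact Nat.lt_succ_self m)))
      have h₂ := ih β (by rw [hβ])
      omega
  exact key _ α rfl

/-- Each class of `(k + 1)`-valued assignments is represented by exactly one evaluation onto a chain
`0 < ⋯ < M + 1` with `M < k`. -/
theorem card_nEquiv_classes (n : ℕ) {k : ℕ} (hk : 1 ≤ k) :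
    Nat.card (Quotient (nEquivSetoid n (k + 1))) = P n k := by
  have hbij : Function.Bijective
      (fun x : Σ M : Fin k, {f : Fin n → Fin (M.1 + 2) // Function.Surjective (eval f)} =>
        Quotient.mk (nEquivSetoid n (k + 1))
          (truncAssignment x.2.1 hk (Nat.le_add_left 1 x.1.1) le_rfl x.1.2)) := by
    constructor
    · rintro ⟨⟨M, hM⟩, f, hf⟩ ⟨⟨N, hN⟩, g, hg⟩ h
      have h' : ∀ α, eval f α = ⊤ ↔ eval g α = ⊤ := fun α => by
        have := (mk_eq_mk_iff _ _).1 h α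
        rw [truncAssignment_eq_one_iff, truncAssignment_eq_one_iff] at this
        rw [← top_le_iff, ← top_le_iff]
        exact this
      have heq : ∀ α, (eval f α).val = (eval g α).val := fun α =>
        le_antisymm (eval_le_eval_of_eq_top_iff hf h' α)
          (eval_le_eval_of_eq_top_iff hg (fun α => (h' α).symm) α)
      have hMN : M = N := Nat.succ.inj (heq .top)
      subst hMN
      have hfg : f = g := funext fun i => Fin.ext (heq (.var i))
      subst hfg
      rfl
    · rintro ⟨ν⟩
      obtain ⟨M, hM, -, f, hs, hf⟩ := exists_eval_of_isPrimeFilter (isPrimeFilter_theory ν.1)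
      have heq : ∀ α, ν.1 α = 1 ↔ M ≤ eval f α := fun α => by
        rw [ν.2.1.eq_one_iff]
        refine (hf (cls α)).trans ?_
        rw [← top_le_iff]; rfl
      have hMk := le_of_eq_one_iff hs le_rfl ν heq
      obtain ⟨m, rfl⟩ : ∃ m, M = m + 1 := ⟨M - 1, by omega⟩
      refine ⟨⟨⟨m, hMk⟩, f, hs⟩, (mk_eq_mk_iff _ _).2 fun α => ?_⟩
      rw [truncAssignment_eq_one_iff, heq]
  rw [← Nat.card_congr (Equiv.ofBijective _ hbij), Nat.card_sigma]
  simp only [surjective_eval_iff, card_onto_interior]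
  rw [Fin.sum_univ_eq_sum_range (fun M => ∑ j ∈ Finset.range (n + 1), n.choose j * T j (M + 1)) k,
    P, Finset.range_eq_Ico, Finset.sum_Ico_add' (fun M =>
      ∑ j ∈ Finset.range (n + 1), n.choose j * T j M) 0 k 1, zero_add]
  rfl

theorem isFinTautology_iff_chi {k : ℕ} (hk : 1 ≤ k) (φ : Form n) :
    IsFinTautology (k + 1) φ ↔ chi k φ = (P n k : ℝ) := by
  rw [isFinTautology_iff, chi_eq_ncard hk, card_nEquiv_classes n hk, Nat.cast_inj]

end GodelLogic

theorem theorem2 (n k : ℕ) (hn : 1 ≤ n) (hk : 1 ≤ k) (φ : GodelLogic.Form n) :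
    -- the generalised characteristics are well defined
    (∃! ν : GodelLogic.Lindenbaum n → ℝ, GodelLogic.IsGenChar n k ν) ∧
    -- (1)
    ((GodelLogic.modelClasses (k + 1) φ).Finite ∧
      GodelLogic.chi k φ = ((GodelLogic.modelClasses (k + 1) φ).ncard : ℝ)) ∧
    -- (2)
    (GodelLogic.IsFinTautology (k + 1) φ ↔ GodelLogic.chi k φ = (GodelLogic.P n k : ℝ)) ∧
    -- (3)
    ((GodelLogic.IsTautology φ ↔ GodelLogic.IsFinTautology (n + 2) φ) ∧
      (GodelLogic.IsFinTautology (n + 2) φ ↔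
        GodelLogic.chi (n + 1) φ = (GodelLogic.P n (n + 1) : ℝ))) :=
  ⟨GodelLogic.existsUnique_isGenChar hk, ⟨Set.toFinite _, GodelLogic.chi_eq_ncard hk φ⟩,
    GodelLogic.isFinTautology_iff_chi hk φ, GodelLogic.isTautology_iff φ,
    GodelLogic.isFinTautology_iff_chi (Nat.le_add_left 1 n) φ⟩
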